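/- **Entropy number for learning quantum measurements.** For a positive integer $d$ let $\mathcal Q(\mathbb C^d)$ be the set of quantum states on $\mathbb C^d$ (positive semi-definite $d\times d$ complex matrices of trace $1$), let $\mathcal E(\mathbb C^d)=\{E: 0\preceq E\preceq I\}$ be the set of effects, and let $\mathcal F_d=\{f_E: E\in\mathcal E(\mathbb C^d)\}$ be the class of functions $f_E:\mathcal Q(\mathbb C^d)\to\mathbb R$, $f_E(\rho)=\mathrm{Tr}(E\rho)$. For a sample $x=(x_1,\dots,x_n)$ of points of $\mathcal Q(\mathbb C^d)$ with empirical measure $\mu_n=n^{-1}\sum_{i=1}^n\delta_{x_i}$, put $\|f\|_{L_2(\mu_n)}=\big(n^{-1}\sum_{i=1}^n|f(x_i)|^2\big)^{1/2}$. Let $\mathcal N(\epsilon,\mathcal F_d,L_2(\mu_n))$ be the least cardinality of a finite set of functions $y_1,\dots,y_m:\mathcal Q(\mathbb C^d)\to\mathbb R$ (not necessarily in $\mathcal F_d$) such that every $f\in\mathcal F_d$ satisfies $\|f-y_j\|_{L_2(\mu_n)}<\epsilon$ for some $j$ (and $\infty$ if there is no such finite set). Let $\mathcal N_2(\epsilon,\mathcal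 F_d,n)=\sup_{\mu_n}\mathcal N(\epsilon,\mathcal F_d,L_2(\mu_n))$, the supremum being over all samples of $n$ points. Then there is an absolute constant $C>0$ such that, for all integers $d\ge 1$ and $n\ge 1$ and all real $\epsilon>0$, $$\log \mathcal N_2(\epsilon,\mathcal F_d,n)\;\le\; C\,\frac{d}{\epsilon^2}.$$ In particular all these covering numbers are finite. -/

import Mathlib

namespace QuantumLearning

open scoped ComplexOrder

/-- The state space of `ℂ^d`: positive semi-definite matrices of unit trace. -/
def StateSpace (d : ℕ) : Type :=
  {ρ : Matrix (Fin d) (Fin d) ℂ // ρ.PosSemidef ∧ ρ.trace = 1}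

/-- The effect space of `ℂ^d`: matrices `E` with `0 ≼ E ≼ 1` in the Loewner order. -/
def effectSpace (d : ℕ) : Set (Matrix (Fin d) (Fin d) ℂ) :=
  {E | E.PosSemidef ∧ (1 - E).PosSemidef}

/-- The functional `f_E : ρ ↦ Tr (E ρ)` on states. The trace is real whenever `E` is Hermitian
(see `ofReal_effectFunctional`), so taking the real part only changes the type of the value. -/
noncomputable def effectFunctional {d : ℕ} (E : Matrix (Fin d) (Fin d) ℂ) :
    StateSpace d → ℝ :=
  fun ρ => ((E * ρ.1).trace).re

theorem ofReal_effectFunctional {d : ℕ} {E : Matrix (Fin d) (Fin d) ℂ}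
    (hE : E ∈ effectSpace d) (ρ : StateSpace d) :
    ((effectFunctional E ρ : ℝ) : ℂ) = (E * ρ.1).trace := by
  refine Complex.conj_eq_iff_re.mp ?_
  change star (E * ρ.1).trace = _
  rw [← Matrix.trace_conjTranspose, Matrix.conjTranspose_mul, ρ.2.1.isHermitian.eq,
    hE.1.isHermitian.eq, Matrix.trace_mul_comm]

/-- The hypothesis class `{f_E : E ∈ ℰ(ℂ^d)}` of functions on the state space. -/
def effectClass (d : ℕ) : Set (StateSpace d → ℝ) :=
  effectFunctional '' effectSpace d

section Covering

/-- `s` is a (finite) `ε`-cover of `F` for the distance function `τ` on `Y`: every `f ∈ F` is at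
distance strictly less than `ε` from some point of `s`. The centres need not belong to `F`. -/
def IsCoverOf {Y : Type*} (τ : Y → Y → ℝ) (ε : ℝ) (F : Set Y) (s : Finset Y) : Prop :=
  ∀ f ∈ F, ∃ y ∈ s, τ f y < ε

/-- The covering number `𝒩(ε, F, τ)`: the minimum cardinality of an `ε`-cover of `F`, and `⊤` if
there is no finite `ε`-cover. -/
noncomputable def coveringNumber {Y : Type*} (ε : ℝ) (F : Set Y) (τ : Y → Y → ℝ) : ℕ∞ :=
  ⨅ (s : Finset Y) (_ : IsCoverOf τ ε F s), (s.card : ℕ∞)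

/-- The seminorm `‖f‖_{L_p(μ_n)} = (n⁻¹ ∑ᵢ |f(xᵢ)|^p)^{1/p}`, `1 ≤ p < ∞`, of the empirical measure
`μ_n` of the sample `x`. -/
noncomputable def empiricalNorm {X : Type*} {n : ℕ} (p : ℝ) (x : Fin n → X) (f : X → ℝ) : ℝ :=
  ((n : ℝ)⁻¹ * ∑ i, |f (x i)| ^ p) ^ (1 / p)

/-- The empirical covering number `𝒩_p(ε, F, n) = sup_{μ_n} 𝒩(ε, F, L_p(μ_n))`, the supremum being
over all samples of `n` points (with repetitions allowed). -/
noncomputable def empiricalCoveringNumber {X : Type*} (p ε : ℝ) (F : Set (X → ℝ)) (n : ℕ) : ℕ∞ :=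
  ⨆ x : Fin n → X, coveringNumber ε F (fun f g => empiricalNorm p x (f - g))

/-- The entropy number `log 𝒩_p(ε, F, n)` (natural logarithm), as an extended real number, with
value `⊤` if the covering number is infinite. -/
noncomputable def entropyNumber {X : Type*} (p ε : ℝ) (F : Set (X → ℝ)) (n : ℕ) : EReal :=
  ENNReal.log (ENat.toENNReal (empiricalCoveringNumber p ε F n))

end Covering

end QuantumLearning

open MeasureTheory ProbabilityTheory
open scoped ENNReal

/-! This is a dual Sudakov argument. In real coordinates `f_E(ρ)` is an inner product, effects lie
in a Hilbert–Schmidt ball of squared radius `d`, and states in the unit ball. So the squared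
empirical norm is a quadratic form `q` (`sumSqForm`) whose mean under the standard Gaussian measure
is at most 1, whatever the dimension and `n`.

By Markov, `{q < 2}` has Gaussian measure at least 1/2. A translate by `v` of this symmetric set
keeps at least the fraction `exp (-‖v‖² / 2)` of it (`exp_mul_le_pi_gaussianReal_translate`).
Translates by well-separated points are disjoint, which bounds a packing
(`card_mul_exp_le_two_of_separated`); a maximal packing is a cover
(`exists_finset_cover_sumSqForm`). -/

/-! ### Translates of Gaussian measures -/

lemma gaussianReal_eq_withDensity_exp (v : ℝ) :
    gaussianReal v 1 =
      (gaussianReal 0 1).withDensity (fun y => ENNReal.ofReal (Real.exp (v * y - v ^ 2 / 2))) := by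
  rw [gaussianReal_of_var_ne_zero _ one_ne_zero, gaussianReal_of_var_ne_zero _ one_ne_zero,
    ← withDensity_mul _ (measurable_gaussianPDF _ _) (by fun_prop)]
  congr 1
  ext y
  simp only [Pi.mul_apply, gaussianPDF, gaussianPDFReal]
  rw [← ENNReal.ofReal_mul (by positivity), mul_assoc _ (Real.exp _) (Real.exp _), ← Real.exp_add]
  congr 3
  simp
  ring

lemma integrable_exp_gaussian_shift (v : ℝ) :
    Integrable (fun y => Real.exp (v * y - v ^ 2 / 2)) (gaussianReal 0 1) := by
  simp_rw [sub_eq_add_neg, Real.exp_add]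
  exact (integrable_exp_mul_gaussianReal v).mul_const _

lemma gaussianReal_apply_eq_ofReal_integral_exp (v : ℝ) {s : Set ℝ} (hs : MeasurableSet s) :
    gaussianReal v 1 s =
      ENNReal.ofReal (∫ y in s, Real.exp (v * y - v ^ 2 / 2) ∂gaussianReal 0 1) := by
  rw [gaussianReal_eq_withDensity_exp, withDensity_apply _ hs,
    ofReal_integral_eq_lintegral_ofReal (integrable_exp_gaussian_shift v).integrableOn
      (ae_of_all _ fun _ => (Real.exp_pos _).le)]

lemma pi_gaussianReal_eq_withDensity_exp {ι : Type*} [Fintype ι] (v : ι → ℝ) :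
    Measure.pi (fun i => gaussianReal (v i) 1) =
      (Measure.pi (fun _ : ι => gaussianReal 0 1)).withDensity
        (fun y => ENNReal.ofReal (∏ i, Real.exp (v i * y i - v i ^ 2 / 2))) := by
  refine Measure.pi_eq fun s hs => ?_
  rw [withDensity_apply _ (MeasurableSet.univ_pi hs), Measure.restrict_pi_pi,
    ← ofReal_integral_eq_lintegral_ofReal, integral_fintype_prod_eq_prod
      (f := fun i y => Real.exp (v i * y - v i ^ 2 / 2)), ENNReal.ofReal_prod_of_nonneg]
  · exact Finset.prod_congr rfl fun i _ =>
      (gaussianReal_apply_eq_ofReal_integral_exp (v i) (hs i)).symm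
  · exact fun i _ => integral_nonneg fun _ => (Real.exp_pos _).le
  · exact Integrable.fintype_prod (f := fun i y => Real.exp (v i * y - v i ^ 2 / 2))
      fun i => (integrable_exp_gaussian_shift (v i)).integrableOn
  · exact ae_of_all _ fun _ => Finset.prod_nonneg fun _ _ => (Real.exp_pos _).le

/-- The standard Gaussian measure of a translate of a symmetric set. -/
lemma exp_mul_le_pi_gaussianReal_translate {ι : Type*} [Fintype ι] (v : ι → ℝ) {K : Set (ι → ℝ)}
    (hK : MeasurableSet K) (hsymm : ∀ x, -x ∈ K ↔ x ∈ K) :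
    ENNReal.ofReal (Real.exp (-(∑ i, v i ^ 2) / 2)) *
        Measure.pi (fun _ : ι => gaussianReal 0 1) K ≤
      Measure.pi (fun _ : ι => gaussianReal 0 1) {y | y + v ∈ K} := by
  set μ := Measure.pi (fun _ : ι => gaussianReal 0 1) with hμ
  have hmap : μ.map (fun y => y + v) = Measure.pi (fun i => gaussianReal (v i) 1) := by
    have h := Measure.pi_map_pi (μ := fun _ : ι => gaussianReal 0 1) (f := fun i x => x + v i)
      fun i => by fun_prop
    simp only [gaussianReal_map_add_const, zero_add] at h
    exact h
  have hneg : μ.map (fun y => -y) = μ := by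
    have h := Measure.pi_map_pi (μ := fun _ : ι => gaussianReal 0 1) (f := fun _ x => -x)
      fun i => by fun_prop
    simp only [gaussianReal_map_neg, neg_zero] at h
    exact h
  set D : (ι → ℝ) → ℝ≥0∞ := fun y => ENNReal.ofReal (∏ i, Real.exp (v i * y i - v i ^ 2 / 2))
  have hD : Measurable D := by fun_prop
  have hval : μ {y | y + v ∈ K} = ∫⁻ y in K, D y ∂μ := by
    rw [← withDensity_apply _ hK, ← pi_gaussianReal_eq_withDensity_exp, ← hmap,
      Measure.map_apply (by fun_prop) hK]
    rfl
  have hrefl : ∫⁻ y in K, D y ∂μ = ∫⁻ y in K, D (-y) ∂μ := by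
    conv_lhs => rw [← hneg, setLIntegral_map hK hD measurable_neg]
    congr 2
    ext x
    exact hsymm x
  -- The right side is `2 exp(-‖v‖²/2) cosh ⟪v, y⟫`; adding `exp t ≥ 1 + t` for `t = ±⟪v, y⟫`
  -- suffices.
  have hpt (y : ι → ℝ) : 2 * ENNReal.ofReal (Real.exp (-(∑ i, v i ^ 2) / 2)) ≤ D y + D (-y) := by
    have h (z : ι → ℝ) : ∏ i, Real.exp (v i * z i - v i ^ 2 / 2) =
        Real.exp (-(∑ i, v i ^ 2) / 2) * Real.exp (∑ i, v i * z i) := by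
      rw [← Real.exp_sum, ← Real.exp_add, Finset.sum_sub_distrib, ← Finset.sum_div]
      ring_nf
    simp only [D]
    rw [← ENNReal.ofReal_add (by positivity) (by positivity), h, h, ← mul_add,
      ← ENNReal.ofReal_ofNat 2, ← ENNReal.ofReal_mul (by norm_num), mul_comm (2 : ℝ)]
    refine ENNReal.ofReal_le_ofReal (mul_le_mul_of_nonneg_left ?_ (Real.exp_pos _).le)
    have h1 := Real.add_one_le_exp (∑ i, v i * y i)
    have h2 := Real.add_one_le_exp (∑ i, v i * (-y) i)
    simp only [Pi.neg_apply, mul_neg, Finset.sum_neg_distrib] at h2 ⊢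
    linarith
  have h2 : 2 * (ENNReal.ofReal (Real.exp (-(∑ i, v i ^ 2) / 2)) * μ K) ≤
      2 * μ {y | y + v ∈ K} := by
    calc _ = ∫⁻ _ in K, 2 * ENNReal.ofReal (Real.exp (-(∑ i, v i ^ 2) / 2)) ∂μ := by
          rw [lintegral_const, Measure.restrict_apply_univ, mul_assoc]
      _ ≤ ∫⁻ y in K, (D y + D (-y)) ∂μ := lintegral_mono fun y => hpt y
      _ = 2 * μ {y | y + v ∈ K} := by
          rw [lintegral_add_left hD, ← hrefl, ← hval, two_mul]
  exact (ENNReal.mul_le_mul_iff_right two_ne_zero ENNReal.ofNat_ne_top).mp h2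

/-! ### Gaussian second moments -/

lemma memLp_eval_pi_gaussianReal {ι : Type*} [Fintype ι] (i : ι) :
    MemLp (fun x : ι → ℝ => x i) 2 (Measure.pi fun _ : ι => gaussianReal 0 1) :=
  (memLp_id_gaussianReal' 2 (by simp)).comp_measurePreserving
    (measurePreserving_eval (fun _ : ι => gaussianReal 0 1) i)

lemma memLp_dotProduct_pi_gaussianReal {ι : Type*} [Fintype ι] (a : ι → ℝ) :
    MemLp (fun x : ι → ℝ => a ⬝ᵥ x) 2 (Measure.pi fun _ : ι => gaussianReal 0 1) :=
  memLp_finsetSum (f := fun i (x : ι → ℝ) => a i * x i) _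
    fun i _ => (memLp_eval_pi_gaussianReal i).const_mul _

/-- The terms `a i * x i` are independent and centred with variance `a i ^ 2`, and variances add. -/
lemma integral_dotProduct_sq_pi_gaussianReal {ι : Type*} [Fintype ι] (a : ι → ℝ) :
    ∫ x, (a ⬝ᵥ x) ^ 2 ∂(Measure.pi fun _ : ι => gaussianReal 0 1) = ∑ i, a i ^ 2 := by
  have hmean : ∫ x, a ⬝ᵥ x ∂(Measure.pi fun _ : ι => gaussianReal 0 1) = 0 := by
    simp only [dotProduct]
    rw [integral_finsetSum _ fun i _ =>
      ((memLp_eval_pi_gaussianReal i).const_mul _).integrable one_le_two]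
    refine Finset.sum_eq_zero fun i _ => ?_
    rw [integral_const_mul]
    have := integral_comp_eval (μ := fun _ : ι => gaussianReal 0 1) (i := i)
      (f := id) (by fun_prop)
    simp only [id, integral_id_gaussianReal] at this
    rw [this, mul_zero]
  rw [← variance_of_integral_eq_zero
    (memLp_dotProduct_pi_gaussianReal a).aestronglyMeasurable.aemeasurable hmean]
  have h := variance_sum_pi (μ := fun _ : ι => gaussianReal 0 1) (X := fun i x => a i * x)
    fun i => (memLp_id_gaussianReal' 2 (by simp)).const_mul _
  have hvar (i : ι) : Var[fun x => a i * x; gaussianReal 0 1] = a i ^ 2 := by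
    simpa using variance_const_mul (a i) (fun x => x) (gaussianReal 0 1)
  simp only [hvar] at h
  rw [← h]
  congr 1
  ext x
  simp [dotProduct]

/-- The quadratic form `x ↦ ∑ k, ⟪a k, x⟫²`. -/
def sumSqForm {κ ι : Type*} [Fintype κ] [Fintype ι] (a : κ → ι → ℝ) (x : ι → ℝ) : ℝ :=
  ∑ k, (a k ⬝ᵥ x) ^ 2

/-! ### Packing and covering for a quadratic form -/

section sumSqForm

variable {κ ι : Type*} [Fintype κ] [Fintype ι] (a : κ → ι → ℝ)

lemma sumSqForm_nonneg (x : ι → ℝ) : 0 ≤ sumSqForm a x :=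
  Finset.sum_nonneg fun _ _ => sq_nonneg _

@[fun_prop]
lemma measurable_sumSqForm : Measurable (sumSqForm a) := by
  unfold sumSqForm dotProduct
  fun_prop

lemma sumSqForm_neg (x : ι → ℝ) : sumSqForm a (-x) = sumSqForm a x := by
  simp [sumSqForm]

lemma sumSqForm_smul (c : ℝ) (x : ι → ℝ) : sumSqForm a (c • x) = c ^ 2 * sumSqForm a x := by
  simp [sumSqForm, mul_pow, Finset.mul_sum]

lemma sumSqForm_sub_le (x y : ι → ℝ) :
    sumSqForm a (x - y) ≤ 2 * sumSqForm a x + 2 * sumSqForm a y := by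
  simp only [sumSqForm, Finset.mul_sum, ← Finset.sum_add_distrib, dotProduct_sub]
  exact Finset.sum_le_sum fun k _ => by nlinarith [sq_nonneg (a k ⬝ᵥ x + a k ⬝ᵥ y)]

lemma sumSqForm_le (x : ι → ℝ) :
    sumSqForm a x ≤ (∑ k, ∑ i, a k i ^ 2) * ∑ i, x i ^ 2 := by
  rw [Finset.sum_mul]
  exact Finset.sum_le_sum fun k _ => Finset.sum_mul_sq_le_sq_mul_sq _ _ _

/-- Markov's inequality at level 2: the mean of the form is `∑ k, ‖a k‖² ≤ 1`. -/
lemma half_le_pi_gaussianReal_sumSqForm_lt (ha : ∑ k, ∑ i, a k i ^ 2 ≤ 1) :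
    (1 / 2 : ℝ) ≤ (Measure.pi fun _ : ι => gaussianReal 0 1).real {x | sumSqForm a x < 2} := by
  set μ := Measure.pi fun _ : ι => gaussianReal 0 1
  have hsq (k : κ) : Integrable (fun x => (a k ⬝ᵥ x) ^ 2) μ :=
    (memLp_dotProduct_pi_gaussianReal (a k)).integrable_sq
  have hint : ∫ x, sumSqForm a x ∂μ ≤ 1 := by
    simp only [sumSqForm]
    rw [integral_finsetSum _ fun k _ => hsq k]
    simpa only [μ, integral_dotProduct_sq_pi_gaussianReal] using ha
  have hmarkov := mul_meas_ge_le_integral_of_nonneg (μ := μ)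
    (ae_of_all _ (sumSqForm_nonneg a)) (integrable_finsetSum _ fun k _ => hsq k) 2
  have hcompl : {x | sumSqForm a x < 2} = {x | 2 ≤ sumSqForm a x}ᶜ := by
    ext x
    simp
  rw [hcompl, probReal_compl_eq_one_sub (measurableSet_le measurable_const (by fun_prop))]
  linarith

/-- Volumetric packing bound with respect to the Gaussian measure. -/
lemma card_mul_exp_le_two_of_separated (ha : ∑ k, ∑ i, a k i ^ 2 ≤ 1) {R : ℝ}
    (t : Finset (ι → ℝ)) (hR : ∀ v ∈ t, ∑ i, v i ^ 2 ≤ R)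
    (hsep : ∀ v ∈ t, ∀ w ∈ t, v ≠ w → 8 ≤ sumSqForm a (v - w)) :
    (t.card : ℝ) * Real.exp (-R / 2) ≤ 2 := by
  set μ := Measure.pi fun _ : ι => gaussianReal 0 1
  set K : Set (ι → ℝ) := {x | sumSqForm a x < 2}
  have hK : MeasurableSet K := measurableSet_lt (by fun_prop) measurable_const
  have hlow (v) (hv : v ∈ t) : Real.exp (-R / 2) * (1 / 2) ≤ μ.real {y | y + v ∈ K} := by
    have h := ENNReal.toReal_mono (by finiteness) (exp_mul_le_pi_gaussianReal_translate v hK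
      fun x => by simp [K, sumSqForm_neg])
    rw [ENNReal.toReal_mul, ENNReal.toReal_ofReal (Real.exp_pos _).le] at h
    refine le_trans ?_ h
    gcongr
    · exact hR v hv
    · exact half_le_pi_gaussianReal_sumSqForm_lt a ha
  have hdisj : (t : Set (ι → ℝ)).PairwiseDisjoint fun v => {y | y + v ∈ K} := by
    intro v hv w hw hvw
    refine Set.disjoint_left.mpr fun y hyv hyw => ?_
    -- A common point would give `q (v - w) < 2 * 2 + 2 * 2 = 8`, against the separation.
    have h := sumSqForm_sub_le a (y + v) (y + w)
    rw [add_sub_add_left_eq_sub] at h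
    have h8 := hsep v hv w hw hvw
    simp only [K, Set.mem_ofPred_eq] at hyv hyw
    linarith
  have hsum : ∑ v ∈ t, μ.real {y | y + v ∈ K} ≤ 1 := by
    rw [← measureReal_biUnion_finset hdisj fun v _ => (by fun_prop : Measurable (· + v)) hK]
    exact measureReal_le_one
  have h := (Finset.sum_le_sum hlow).trans hsum
  rw [Finset.sum_const, nsmul_eq_mul] at h
  linarith

/-- Entropy bound for the image of a Euclidean ball under a Hilbert–Schmidt operator. -/
lemma exists_finset_cover_sumSqForm (ha : ∑ k, ∑ i, a k i ^ 2 ≤ 1) {R ε : ℝ} (hε : 0 < ε)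
    (T : Set (ι → ℝ)) (hT : ∀ v ∈ T, ∑ i, v i ^ 2 ≤ R) :
    ∃ t : Finset (ι → ℝ), (∀ v ∈ T, ∃ w ∈ t, sumSqForm a (v - w) < ε ^ 2) ∧
      (t.card : ℝ) ≤ Real.exp (5 * (R / ε ^ 2)) := by
  classical
  rcases T.eq_empty_or_nonempty with rfl | ⟨v₀, hv₀⟩
  · exact ⟨∅, by simp, by simpa using (Real.exp_pos _).le⟩
  have hR : 0 ≤ R := (Finset.sum_nonneg fun _ _ => sq_nonneg _).trans (hT v₀ hv₀)
  rcases lt_or_ge R (ε ^ 2) with hlt | hge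
  -- The form is at most `R < ε ^ 2` on `T`, so the centre 0 alone suffices.
  · refine ⟨{0}, fun v hv => ⟨0, Finset.mem_singleton_self _, ?_⟩, ?_⟩
    · rw [sub_zero]
      have h0 : 0 ≤ ∑ i, v i ^ 2 := Finset.sum_nonneg fun _ _ => sq_nonneg _
      nlinarith [sumSqForm_le a v, hT v hv, mul_le_mul_of_nonneg_right ha h0]
    · simpa using by positivity
  have hbound (t : Finset (ι → ℝ)) (htT : (t : Set (ι → ℝ)) ⊆ T)
      (hsep : ∀ v ∈ t, ∀ w ∈ t, v ≠ w → ε ^ 2 ≤ sumSqForm a (v - w)) :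
      (t.card : ℝ) ≤ Real.exp (5 * (R / ε ^ 2)) := by
    -- Scaling by `c` turns separation `ε ^ 2` into 8 and `R` into `8 * R / ε ^ 2`.
    set c : ℝ := √8 / ε
    have hc0 : c ≠ 0 := by positivity
    have hc : c ^ 2 = 8 / ε ^ 2 := by rw [div_pow, Real.sq_sqrt (by norm_num)]
    have h := card_mul_exp_le_two_of_separated a ha (R := c ^ 2 * R)
      (t.image fun v => c • v) ?_ ?_
    · rw [Finset.card_image_of_injective _ (smul_right_injective _ hc0)] at h
      have hexp : Real.exp (-(c ^ 2 * R) / 2) = (Real.exp (4 * (R / ε ^ 2)))⁻¹ := by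
        rw [← Real.exp_neg, hc]
        ring_nf
      rw [hexp, ← div_eq_mul_inv, div_le_iff₀ (Real.exp_pos _)] at h
      -- Since `R ≥ ε ^ 2`, the factor 2 is absorbed by raising the exponent's constant from 4 to 5.
      have h1 : 1 ≤ R / ε ^ 2 := (one_le_div (by positivity)).mpr hge
      have h2 : 2 ≤ Real.exp (R / ε ^ 2) := by linarith [Real.add_one_le_exp (R / ε ^ 2)]
      calc (t.card : ℝ) ≤ _ := h
        _ ≤ Real.exp (R / ε ^ 2) * Real.exp (4 * (R / ε ^ 2)) := by gcongr
        _ = Real.exp (5 * (R / ε ^ 2)) := by rw [← Real.exp_add]; ring_nf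
    · simp only [Finset.forall_mem_image, Pi.smul_apply, smul_eq_mul, mul_pow, ← Finset.mul_sum]
      exact fun v hv => by gcongr; exact hT v (htT hv)
    · simp only [Finset.forall_mem_image, ← smul_sub, sumSqForm_smul]
      intro v hv w hw hne
      have := hsep v hv w hw fun h => hne (by rw [h])
      rw [hc, div_mul_eq_mul_div, le_div_iff₀ (by positivity)]
      linarith
  let P (m : ℕ) : Prop := ∃ t : Finset (ι → ℝ), t.card = m ∧ (t : Set (ι → ℝ)) ⊆ T ∧
    ∀ v ∈ t, ∀ w ∈ t, v ≠ w → ε ^ 2 ≤ sumSqForm a (v - w)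
  have hP0 : P 0 := ⟨∅, by simp⟩
  have hPle (m : ℕ) (hm : P m) : m ≤ ⌊Real.exp (5 * (R / ε ^ 2))⌋₊ := by
    obtain ⟨t, rfl, htT, hsep⟩ := hm
    exact Nat.le_floor (hbound t htT hsep)
  -- A separated subset of maximal cardinality; an uncovered point could be added to it.
  obtain ⟨t, htc, htT, hsep⟩ := Nat.findGreatest_spec (P := P) (Nat.zero_le _) hP0
  refine ⟨t, fun v hv => ?_, hbound t htT hsep⟩
  by_contra! hcon
  have hvt : v ∉ t := fun hvt => by
    have := hcon v hvt
    simp only [sub_self, sumSqForm, dotProduct_zero] at this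
    simp_all [hε.ne']
  have hins : P (t.card + 1) := by
    refine ⟨insert v t, Finset.card_insert_of_notMem hvt, ?_, ?_⟩
    · rw [Finset.coe_insert]
      exact Set.insert_subset hv htT
    · intro x hx y hy hxy
      rcases Finset.mem_insert.mp hx with rfl | hx' <;>
        rcases Finset.mem_insert.mp hy with rfl | hy'
      · exact absurd rfl hxy
      · exact hcon y hy'
      · rw [← neg_sub, sumSqForm_neg]
        exact hcon x hx'
      · exact hsep x hx' y hy' hxy
  have hlast := Nat.le_findGreatest (hPle _ hins) hins
  rw [htc] at hlast
  exact absurd hlast (Nat.not_succ_le_self _)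

end sumSqForm
namespace QuantumLearning
open scoped ComplexOrder

/-! ### Hilbert–Schmidt bounds and the cover of the effect class -/

lemma sum_normSq_le_of_mem_effectSpace {d : ℕ} {E : Matrix (Fin d) (Fin d) ℂ}
    (hE : E ∈ effectSpace d) : ∑ i, ∑ j, Complex.normSq (E i j) ≤ d := by
  obtain ⟨h0, h1⟩ := hE
  have hE' := h0.isHermitian.eq
  -- The bracket is `E - E²` written as a sum of positive semi-definite matrices, so `Tr E² ≤ Tr E ≤
  -- d`.
  have hs : E * E = E - (E * (1 - E) * E.conjTranspose +
      (1 - E) * E * (1 - E).conjTranspose) := by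
    rw [Matrix.conjTranspose_sub, Matrix.conjTranspose_one, hE']
    noncomm_ring
  have ht : (∑ i, ∑ j, Complex.normSq (E i j) : ℝ) = (E * E).trace.re := by
    conv_rhs => enter [1, 1, 2]; rw [← hE']
    simp [Matrix.trace, Matrix.mul_apply, Complex.normSq_apply]
  have h2 := (Complex.le_def.mp ((h1.mul_mul_conjTranspose_same E).add
    (h0.mul_mul_conjTranspose_same (1 - E))).trace_nonneg).1
  have h3 := (Complex.le_def.mp h1.trace_nonneg).1
  rw [Matrix.trace_sub, Matrix.trace_one, Fintype.card_fin] at h3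
  rw [ht, hs, Matrix.trace_sub]
  simp only [Complex.sub_re, Complex.zero_re, Complex.natCast_re] at h2 h3 ⊢
  linarith

/-- Nonnegative 2×2 minors give `|ρ i j|² ≤ ρ i i * ρ j j`, and the right side sums to `(Tr ρ)² =
1`. -/
lemma sum_normSq_le_one_of_state {d : ℕ} (ρ : StateSpace d) :
    ∑ i, ∑ j, Complex.normSq (ρ.1 i j) ≤ 1 := by
  obtain ⟨ρ, hρ, htr⟩ := ρ
  have hdiag (i : Fin d) : ((ρ i i).re : ℂ) = ρ i i :=
    Complex.conj_eq_iff_re.mp (hρ.isHermitian.apply i i)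
  have hminor (i j : Fin d) : Complex.normSq (ρ i j) ≤ (ρ i i).re * (ρ j j).re := by
    have h := (hρ.submatrix ![i, j]).det_nonneg
    rw [Matrix.det_fin_two] at h
    simp only [Matrix.submatrix_apply, Matrix.cons_val_zero, Matrix.cons_val_one] at h
    have hji : ρ j i = (starRingEnd ℂ) (ρ i j) := (hρ.isHermitian.apply j i).symm
    rw [hji, Complex.mul_conj, ← hdiag i, ← hdiag j, ← Complex.ofReal_mul, ← Complex.ofReal_sub,
      Complex.zero_le_real] at h
    linarith
  have htr' : ∑ i, (ρ i i).re = 1 := by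
    have := congrArg Complex.re htr
    simpa [Matrix.trace] using this
  calc _ ≤ ∑ i, ∑ j, (ρ i i).re * (ρ j j).re :=
        Finset.sum_le_sum fun i _ => Finset.sum_le_sum fun j _ => hminor i j
    _ = 1 := by rw [← Finset.sum_mul_sum, htr', one_mul]

/-- The real and imaginary parts of the entries of a matrix. -/
def realCoords {d : ℕ} (M : Matrix (Fin d) (Fin d) ℂ) : Fin d × Fin d × Fin 2 → ℝ :=
  fun p => ![(M p.1 p.2.1).re, (M p.1 p.2.1).im] p.2.2

lemma sum_realCoords_sq {d : ℕ} (M : Matrix (Fin d) (Fin d) ℂ) :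
    ∑ p, realCoords M p ^ 2 = ∑ i, ∑ j, Complex.normSq (M i j) := by
  simp [Fintype.sum_prod_type, realCoords, Complex.normSq_apply, sq]

/-- Hermitian symmetry of `ρ` turns `Re (E i j * ρ j i)` into the real inner product of the entries
at `(i, j)`. -/
lemma realCoords_dotProduct {d : ℕ} (ρ : StateSpace d) (E : Matrix (Fin d) (Fin d) ℂ) :
    realCoords ρ.1 ⬝ᵥ realCoords E = effectFunctional E ρ := by
  have h (i j : Fin d) : ρ.1 j i = (starRingEnd ℂ) (ρ.1 i j) :=
    (ρ.2.1.isHermitian.apply j i).symm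
  simp only [dotProduct, Fintype.sum_prod_type, realCoords, effectFunctional, Matrix.trace,
    Matrix.diag, Matrix.mul_apply, Complex.re_sum, Fin.sum_univ_two, Complex.mul_re]
  refine Finset.sum_congr rfl fun i _ => Finset.sum_congr rfl fun j _ => ?_
  rw [h i j]
  simp
  ring

/-- The function on states given by the pairing with a vector of real coordinates. -/
def coordFunctional {d : ℕ} (v : Fin d × Fin d × Fin 2 → ℝ) : StateSpace d → ℝ :=
  fun ρ => realCoords ρ.1 ⬝ᵥ v

lemma empiricalNorm_coordFunctional {d n : ℕ} (x : Fin n → StateSpace d)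
    (v : Fin d × Fin d × Fin 2 → ℝ) :
    empiricalNorm 2 x (coordFunctional v) =
      √(sumSqForm (fun k => (√(n : ℝ))⁻¹ • realCoords (x k).1) v) := by
  rw [empiricalNorm, ← Real.sqrt_eq_rpow]
  simp [sumSqForm, coordFunctional, mul_pow, Finset.mul_sum, smul_dotProduct]

lemma exists_isCoverOf_effectClass {d n : ℕ} (hn : 0 < n) {ε : ℝ} (hε : 0 < ε)
    (x : Fin n → StateSpace d) :
    ∃ s : Finset (StateSpace d → ℝ),
      IsCoverOf (fun f g => empiricalNorm 2 x (f - g)) ε (effectClass d) s ∧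
        (s.card : ℝ) ≤ Real.exp (5 * ((d : ℝ) / ε ^ 2)) := by
  classical
  -- The weight `1/√n` averages `n` squared norms, each at most 1.
  have ha : ∑ k, ∑ p, ((√(n : ℝ))⁻¹ • realCoords (x k).1) p ^ 2 ≤ 1 := by
    simp only [Pi.smul_apply, smul_eq_mul, mul_pow, ← Finset.mul_sum, sum_realCoords_sq, inv_pow,
      Real.sq_sqrt (Nat.cast_nonneg n)]
    rw [inv_mul_le_one₀ (by positivity)]
    exact (Finset.sum_le_sum fun k _ => sum_normSq_le_one_of_state (x k)).trans (by simp)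
  obtain ⟨t, hcover, hcard⟩ := exists_finset_cover_sumSqForm _ ha hε (realCoords '' effectSpace d)
    (R := d) (by
      rintro _ ⟨E, hE, rfl⟩
      rw [sum_realCoords_sq]
      exact sum_normSq_le_of_mem_effectSpace hE)
  refine ⟨t.image coordFunctional, ?_, le_trans (mod_cast Finset.card_image_le) hcard⟩
  rintro _ ⟨E, hE, rfl⟩
  obtain ⟨w, hw, hlt⟩ := hcover _ ⟨E, hE, rfl⟩
  refine ⟨_, Finset.mem_image_of_mem _ hw, ?_⟩
  have hsub : effectFunctional E - coordFunctional w = coordFunctional (realCoords E - w) := by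
    ext ρ
    simp [coordFunctional, dotProduct_sub, realCoords_dotProduct]
  dsimp only
  rw [hsub, empiricalNorm_coordFunctional, Real.sqrt_lt' hε]
  exact hlt

lemma entropyNumber_le_of_forall_exists_cover {X : Type*} {p ε b : ℝ} {F : Set (X → ℝ)} {n : ℕ}
    (h : ∀ x : Fin n → X, ∃ s : Finset (X → ℝ),
      IsCoverOf (fun f g => empiricalNorm p x (f - g)) ε F s ∧ (s.card : ℝ) ≤ Real.exp b) :
    entropyNumber p ε F n ≤ (b : EReal) := by
  -- The bound is uniform in the sample, so it survives the supremum and rules out the value `⊤`.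
  have hle : empiricalCoveringNumber p ε F n ≤ ((⌊Real.exp b⌋₊ : ℕ) : ℕ∞) := by
    refine iSup_le fun x => ?_
    obtain ⟨s, hs, hcard⟩ := h x
    exact (iInf₂_le s hs).trans (mod_cast Nat.le_floor hcard)
  have hle' : ENat.toENNReal (empiricalCoveringNumber p ε F n) ≤ ENNReal.ofReal (Real.exp b) := by
    refine (ENat.toENNReal_le.mpr hle).trans ?_
    rw [ENat.toENNReal_coe, ← ENNReal.ofReal_natCast]
    exact ENNReal.ofReal_le_ofReal (Nat.floor_le (Real.exp_pos b).le)
  refine (ENNReal.log_monotone hle').trans ?_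
  rw [ENNReal.log_ofReal_of_pos (Real.exp_pos b), Real.log_exp]

end QuantumLearning

theorem mainTheorem5 :
    ∃ C : ℝ, 0 < C ∧ ∀ d : ℕ, 0 < d → ∀ n : ℕ, 0 < n → ∀ ε : ℝ, 0 < ε →
      QuantumLearning.entropyNumber 2 ε (QuantumLearning.effectClass d) n ≤
        ((C * ((d : ℝ) / ε ^ 2) : ℝ) : EReal) := by
  refine ⟨5, by norm_num, fun d _ n hn ε hε => ?_⟩
  exact QuantumLearning.entropyNumber_le_of_forall_exists_cover
    fun x => QuantumLearning.exists_isCoverOf_effectClass hn hε x
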